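/- Let $(\eta_z)_{z\in\mathbb Z^d}$ be a stationary $\mathbb Z^d$-valued random field on a probability space such that (i) (bounded jumps) there is $L>0$ with $|\eta_z|\le L$ almost surely for every $z\in\mathbb Z^d$; (ii) (finite-range dependence) there is a real number $M$ such that, whenever $A,B\subseteq\mathbb Z^d$ satisfy $|a-b|>M$ for all $a\in A$, $b\in B$, the families $(\eta_z)_{z\in A}$ and $(\eta_z)_{z\in B}$ are independent; (iii) (uniform ellipticity) there are a finite set $\{u_1,\dots,u_m\}\subset\mathbb Z^d$ that is nice, i.e. for every $l\in\mathbb R^d\setminus\{0\}$ some $i$ has $l\cdot u_i>0$, and a constant $c>0$ such that for all $z\in\mathbb Z^d$ and all $i$, almost surely $\mathbb P(\eta_z=u_i\mid \eta_w,\ w\ne z)>c$. Let $X_0=0$ and $X_{n+1}=X_n+\eta_{X_n}$. For $v\in\mathbb R^d$ put $$\underline\Phi(v)=\liminf_{n\to\infty}\frac1n\log\mathbb P(X_n\cdot v\ge n),\qquad \overline\Phi(v)=\limsup_{n\to\infty}\frac1n\log\mathbb P(X_n\cdot v\ge n)$$ in $[-\infty,0]$, with $\log 0=-\infty$ (both equal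 $\Phi(v)=\lim_{n}\frac1n\log\mathbb P(X_n\cdot v\ge n)$ when this limit exists). Then there is a convex function $\Lambda:\mathbb R^d\to\mathbb R$ (finite everywhere) such that for every $\lambda\in\mathbb R^d$ all the expectations $\mathbb E[e^{\lambda\cdot X_n}]$ are finite, $$\lim_{n\to\infty}\frac1n\log\mathbb E\left[e^{\lambda\cdot X_n}\right]=\Lambda(\lambda),$$ and $$\Lambda(\lambda)=\max\Bigl\{0,\ \sup_{k>0}\bigl(k+\underline\Phi(\lambda/k)\bigr)\Bigr\}=\max\Bigl\{0,\ \sup_{k>0}\bigl(k+\overline\Phi(\lambda/k)\bigr)\Bigr\}.$$ In particular the origin belongs to the interior of $\{\lambda\in\mathbb R^d:\Lambda(\lambda)<+\infty\}$. -/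

import Mathlib

open MeasureTheory ProbabilityTheory Filter Topology
open scoped RealInnerProductSpace

noncomputable section

namespace DetWalk

/-- The lattice point `z ∈ ℤ^d`, seen as a vector of Euclidean space `ℝ^d`. -/
def toVec {d : ℕ} (z : Fin d → ℤ) : EuclideanSpace ℝ (Fin d) :=
  WithLp.toLp 2 (fun i => (z i : ℝ))

/-- A finite set of lattice vectors is nice if every direction `l ≠ 0` has a positive scalar
product with one of them. -/
def Nice {d : ℕ} (U : Finset (Fin d → ℤ)) : Prop :=
  ∀ l : EuclideanSpace ℝ (Fin d), l ≠ 0 → ∃ u ∈ U, 0 < ⟪l, toVec u⟫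

/-- The sigma-algebra generated by the environment `η` at the sites of `A`. -/
@[reducible] def envSigma {d : ℕ} {Ω : Type*} (η : (Fin d → ℤ) → Ω → (Fin d → ℤ))
    (A : Set (Fin d → ℤ)) : MeasurableSpace Ω :=
  ⨆ z ∈ A, MeasurableSpace.comap (η z) inferInstance

/-- The assumptions on the random environment `(η_z)` indexed by `z ∈ ℤ^d`. -/
structure IsEnvironment {d : ℕ} {Ω : Type*} [MeasurableSpace Ω] (μ : Measure Ω)
    (η : (Fin d → ℤ) → Ω → (Fin d → ℤ)) : Prop where
  measurable : ∀ z, Measurable (η z)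
  /-- The joint law of the field is invariant under the translations of `ℤ^d`. -/
  stationary : ∀ a : Fin d → ℤ,
    μ.map (fun ω z => η (z + a) ω) = μ.map (fun ω z => η z ω)
  /-- Bounded jumps. -/
  bounded : ∃ L : ℝ, 0 < L ∧ ∀ z, ∀ᵐ ω ∂μ, ‖toVec (η z ω)‖ ≤ L
  /-- Finite-range dependence: the environments over two sets of sites at mutual distances
  larger than `M` are independent. -/
  finiteRange : ∃ M : ℝ, ∀ A B : Set (Fin d → ℤ),
    (∀ a ∈ A, ∀ b ∈ B, M < dist (toVec a) (toVec b)) →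
      Indep (envSigma η A) (envSigma η B) μ
  /-- Uniform ellipticity: given the rest of the environment, each vector of some nice set has a
  conditional probability above a constant `c > 0`. -/
  elliptic : ∃ U : Finset (Fin d → ℤ), Nice U ∧ ∃ c : ℝ, 0 < c ∧ ∀ z, ∀ u ∈ U,
    ∀ᵐ ω ∂μ, c < (μ⟦η z ⁻¹' {u} | envSigma η {w | w ≠ z}⟧) ω

/-- The walk: `X_0 = 0` and `X_{n+1} = X_n + η_{X_n}`. -/
def walk {d : ℕ} {Ω : Type*} (η : (Fin d → ℤ) → Ω → (Fin d → ℤ)) : ℕ → Ω → (Fin d → ℤ)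
  | 0, _ => 0
  | n + 1, ω => walk η n ω + η (walk η n ω) ω

/-- `(1/n) log P(X_n · v ≥ n)` as an extended real number (with `log 0 = -∞`). -/
def tailRate {d : ℕ} {Ω : Type*} [MeasurableSpace Ω] (μ : Measure Ω)
    (η : (Fin d → ℤ) → Ω → (Fin d → ℤ)) (v : EuclideanSpace ℝ (Fin d)) (n : ℕ) : EReal :=
  ((1 / (n : ℝ) : ℝ) : EReal) *
    ENNReal.log (μ {ω | (n : ℝ) ≤ ⟪toVec (walk η n ω), v⟫})

/-- The lower version of `Φ(v) = lim (1/n) log P(X_n · v ≥ n)`. -/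
def lowerPhi {d : ℕ} {Ω : Type*} [MeasurableSpace Ω] (μ : Measure Ω)
    (η : (Fin d → ℤ) → Ω → (Fin d → ℤ)) (v : EuclideanSpace ℝ (Fin d)) : EReal :=
  liminf (tailRate μ η v) atTop

/-- The upper version of `Φ(v) = lim (1/n) log P(X_n · v ≥ n)`. -/
def upperPhi {d : ℕ} {Ω : Type*} [MeasurableSpace Ω] (μ : Measure Ω)
    (η : (Fin d → ℤ) → Ω → (Fin d → ℤ)) (v : EuclideanSpace ℝ (Fin d)) : EReal :=
  limsup (tailRate μ η v) atTop

end DetWalk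

end

/-! The mgf is compared with the tails `P(l · X_n ≥ nk)`. Exponential Chebyshev gives the lower
bound by `k + lowerPhi`. A nice set pushes the walk back towards the origin, so ellipticity traps it
in a fixed ball with probability bounded below in `n`, which gives the lower bound 0. Since heights
grow at most linearly, cutting them into finitely many levels gives the upper bound by `max 0 (sup
(k + upperPhi))`.

The existence of `Φ` is not needed: it suffices that the two suprema, truncated at 0, agree
(`exists_le_add_lowerPhi`). Take one large `N` with `P(l · X_N ≥ Nk) ≥ e^{Ns}`. The path contains a
piece that crosses a slab of height at least `Nk` without leaving it, and a union bound with
stationarity fixes its duration `T ≤ N` and displacement at polynomial cost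
(`exists_crossing_real_ge`). Copies of this crossing in slabs more than `M` apart are independent,
and ellipticity bridges the gaps by a bounded number of forced steps (`real_chain_ge`). Repetition
yields tail bounds at all large times. The speed may change because `T` may be less than `N`, but a
level `t ≥ 0` below `k + s` survives: the gain accumulated over `N` steps is now made in at most `N`
steps plus a bridge. -/

open MeasureTheory ProbabilityTheory Filter Topology
open scoped RealInnerProductSpace

noncomputable section

namespace DetWalk

/-! ### Heights, localized path events, and the cost of forcing sites. -/

section

variable {d : ℕ}

/-- The height of a lattice point in the direction `l`. -/
def height (l : EuclideanSpace ℝ (Fin d)) : (Fin d → ℤ) →+ ℝ where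
  toFun z := ⟪l, toVec z⟫
  map_zero' := by
    have : toVec (0 : Fin d → ℤ) = 0 := by ext i; simp [toVec]
    rw [this, inner_zero_right]
  map_add' x y := by
    have : toVec (x + y) = toVec x + toVec y := by ext i; simp [toVec]
    rw [this, inner_add_right]

lemma height_apply (l : EuclideanSpace ℝ (Fin d)) (z : Fin d → ℤ) :
    height l z = ⟪l, toVec z⟫ := rfl

lemma height_nsmul (l : EuclideanSpace ℝ (Fin d)) (n : ℕ) (z : Fin d → ℤ) :
    height l (n • z) = n * height l z := by
  rw [map_nsmul, nsmul_eq_mul]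

lemma toVec_add (x y : Fin d → ℤ) : toVec (x + y) = toVec x + toVec y := by
  ext i; simp [toVec]

lemma toVec_sub (x y : Fin d → ℤ) : toVec (x - y) = toVec x - toVec y := by
  ext i; simp [toVec]

lemma toVec_zero : toVec (0 : Fin d → ℤ) = 0 := by
  ext i; simp [toVec]

lemma abs_le_norm_toVec (z : Fin d → ℤ) (i : Fin d) : |(z i : ℝ)| ≤ ‖toVec z‖ := by
  simpa [toVec] using PiLp.norm_apply_le (toVec z) i

/-- One step of the walk in the environment `e`. -/
def step (e : (Fin d → ℤ) → (Fin d → ℤ)) (z : Fin d → ℤ) : Fin d → ℤ := z + e z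

lemma step_shift_iterate (e : (Fin d → ℤ) → (Fin d → ℤ)) (a x : Fin d → ℤ) (n : ℕ) :
    (step fun z => e (z + a))^[n] x + a = (step e)^[n] (x + a) := by
  have h : Function.Semiconj (fun z => z + a) (step fun z => e (z + a)) (step e) := by
    intro z
    simp only [step]
    abel
  exact h.iterate_right n x

lemma norm_step_iterate_le {e : (Fin d → ℤ) → (Fin d → ℤ)} {L : ℝ}
    (he : ∀ z, ‖toVec (e z)‖ ≤ L) (n : ℕ) : ‖toVec ((step e)^[n] 0)‖ ≤ n * L := by
  induction n with
  | zero => simp [toVec_zero]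
  | succ n ih =>
    rw [Function.iterate_succ_apply', step, toVec_add]
    calc _ ≤ _ := norm_add_le _ _
      _ ≤ n * L + L := add_le_add ih (he _)
      _ = _ := by push_cast; ring

variable {Ω : Type*}

lemma walk_eq_iterate (η : (Fin d → ℤ) → Ω → (Fin d → ℤ)) (n : ℕ) (ω : Ω) :
    walk η n ω = (step fun z => η z ω)^[n] 0 := by
  induction n with
  | zero => rfl
  | succ n ih => rw [Function.iterate_succ_apply', ← ih]; rfl

lemma envSigma_mono (η : (Fin d → ℤ) → Ω → (Fin d → ℤ)) {A B : Set (Fin d → ℤ)} (h : A ⊆ B) :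
    envSigma η A ≤ envSigma η B :=
  biSup_mono fun _ hz => h hz

lemma envSigma_le [mΩ : MeasurableSpace Ω] {η : (Fin d → ℤ) → Ω → (Fin d → ℤ)}
    (hη : ∀ z, Measurable (η z)) (A : Set (Fin d → ℤ)) : envSigma η A ≤ mΩ :=
  iSup₂_le fun z _ => (hη z).comap_le

lemma measurableSet_envSigma_eq (η : (Fin d → ℤ) → Ω → (Fin d → ℤ)) {A : Set (Fin d → ℤ)}
    {z : Fin d → ℤ} (hz : z ∈ A) (u : Fin d → ℤ) :
    MeasurableSet[envSigma η A] (η z ⁻¹' {u}) :=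
  (le_iSup₂ (f := fun z (_ : z ∈ A) => MeasurableSpace.comap (η z) inferInstance) z hz) _
    ⟨{u}, measurableSet_singleton u, rfl⟩

/-- The walk from `x` has not left `S` before time `T`, when it sits at `y`. -/
def confined (S : Set (Fin d → ℤ)) (T : ℕ) (x y : Fin d → ℤ) :
    Set ((Fin d → ℤ) → (Fin d → ℤ)) :=
  {e | (∀ t < T, (step e)^[t] x ∈ S) ∧ (step e)^[T] x = y}

/-- Only the sites occupied before time `T` are read, so the endpoint `y` may lie outside `S`. This
locality is what gives independence of distant crossings. -/
lemma measurableSet_confined (η : (Fin d → ℤ) → Ω → (Fin d → ℤ)) (S : Set (Fin d → ℤ)) (T : ℕ)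
    (x y : Fin d → ℤ) :
    MeasurableSet[envSigma η S] {ω | (fun z => η z ω) ∈ confined S T x y} := by
  induction T generalizing y with
  | zero => simp [confined]
  | succ T ih =>
    have : {ω | (fun z => η z ω) ∈ confined S (T + 1) x y} =
        ⋃ z ∈ S, {ω | (fun z => η z ω) ∈ confined S T x z} ∩ η z ⁻¹' {y - z} := by
      ext ω
      simp only [confined, Set.mem_ofPred_eq, Set.mem_iUnion, Set.mem_inter_iff, Set.mem_preimage,
        Set.mem_singleton_iff, Function.iterate_succ_apply', exists_prop]
      constructor
      · rintro ⟨h1, h2⟩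
        refine ⟨_, h1 T (by lia), ⟨fun t ht => h1 t (by lia), rfl⟩, ?_⟩
        rw [← h2]
        simp [step]
      · rintro ⟨z, hz, ⟨h1, h2⟩, h3⟩
        refine ⟨fun t ht => ?_, by rw [h2, step, h3]; abel⟩
        rcases Nat.lt_succ_iff_lt_or_eq.1 ht with h | rfl
        · exact h1 t h
        · rwa [h2]
    rw [this]
    exact MeasurableSet.biUnion (Set.to_countable S) fun z hz =>
      (ih z).inter (measurableSet_envSigma_eq η hz _)

lemma measurableSet_confined_pi (S : Set (Fin d → ℤ)) (T : ℕ) (x y : Fin d → ℤ) :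
    MeasurableSet (confined S T x y) :=
  envSigma_le (η := fun z (e : (Fin d → ℤ) → (Fin d → ℤ)) => e z)
    (fun z => measurable_pi_apply z) S _ (measurableSet_confined _ S T x y)

variable [MeasurableSpace Ω]

lemma measurable_walk {η : (Fin d → ℤ) → Ω → (Fin d → ℤ)} (hη : ∀ z, Measurable (η z)) (n : ℕ) :
    Measurable (walk η n) := by
  refine measurable_to_countable' fun y => ?_
  have h := envSigma_le hη Set.univ _ (measurableSet_confined η Set.univ n 0 y)
  convert h using 1
  ext ω
  simp [confined, walk_eq_iterate]

variable {μ : Measure Ω} {η : (Fin d → ℤ) → Ω → (Fin d → ℤ)}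

/-- Crossing of the slab between the heights of `x` and of `x + y` in `T` steps. -/
def crossing (l : EuclideanSpace ℝ (Fin d)) (T : ℕ) (y x : Fin d → ℤ) :
    Set ((Fin d → ℤ) → (Fin d → ℤ)) :=
  confined {z | height l x ≤ height l z ∧ height l z < height l (x + y)} T x (x + y)

lemma shift_mem_crossing_iff (l : EuclideanSpace ℝ (Fin d)) (T : ℕ) (y x : Fin d → ℤ)
    (e : (Fin d → ℤ) → (Fin d → ℤ)) :
    (fun z => e (z + x)) ∈ crossing l T y 0 ↔ e ∈ crossing l T y x := by
  have h : ∀ n, (step fun z => e (z + x))^[n] 0 = (step e)^[n] x - x := fun n => by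
    rw [eq_sub_iff_add_eq, step_shift_iterate, zero_add]
  simp only [crossing, confined, Set.mem_ofPred_eq, h, map_zero, zero_add, map_sub, map_add,
    sub_nonneg, sub_lt_iff_lt_add', sub_eq_iff_eq_add']

lemma measure_crossing_eq (hη : IsEnvironment μ η) (l : EuclideanSpace ℝ (Fin d)) (T : ℕ)
    (y x : Fin d → ℤ) :
    μ {ω | (fun z => η z ω) ∈ crossing l T y x} =
      μ {ω | (fun z => η z ω) ∈ crossing l T y 0} := by
  have hm : MeasurableSet (crossing l T y 0) := measurableSet_confined_pi _ _ _ _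
  have h : (μ.map fun ω z => η (z + x) ω) (crossing l T y 0) =
      (μ.map fun ω z => η z ω) (crossing l T y 0) := by rw [hη.stationary x]
  rw [Measure.map_apply (measurable_pi_lambda _ fun z => hη.measurable _) hm,
    Measure.map_apply (measurable_pi_lambda _ fun z => hη.measurable _) hm] at h
  rw [show {ω | (fun z => η z ω) ∈ crossing l T y x} =
    (fun ω z => η (z + x) ω) ⁻¹' crossing l T y 0 from ?_, h]
  · rfl
  · ext ω
    exact (shift_mem_crossing_iff l T y x fun z => η z ω).symm

/-- The sites of `F` are added one at a time. What has been imposed so far never involves the new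
site, so integrating its conditional probability costs one factor `c`. -/
lemma measure_forced_ge [IsProbabilityMeasure μ] (hm : ∀ z, Measurable (η z))
    {U : Finset (Fin d → ℤ)} {c : ℝ} (hc : 0 < c)
    (hU : ∀ z, ∀ u ∈ U, ∀ᵐ ω ∂μ, c < (μ⟦η z ⁻¹' {u} | envSigma η {w | w ≠ z}⟧) ω)
    {S : Set (Fin d → ℤ)} {A : Set Ω} (hA : MeasurableSet[envSigma η S] A)
    (F : Finset (Fin d → ℤ)) (hF : ∀ z ∈ F, z ∉ S) (f : (Fin d → ℤ) → (Fin d → ℤ))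
    (hf : ∀ z ∈ F, f z ∈ U) :
    c ^ F.card * μ.real A ≤ μ.real (A ∩ {ω | ∀ z ∈ F, η z ω = f z}) := by
  induction F using Finset.induction_on with
  | empty => simp
  | insert z F hz ih =>
    have ih := ih (fun z hz => hF z (by simp [hz])) (fun z hz => hf z (by simp [hz]))
    set B := A ∩ {ω | ∀ z ∈ F, η z ω = f z} with hB
    have hBm : MeasurableSet[envSigma η {w | w ≠ z}] B := by
      refine MeasurableSet.inter (envSigma_mono η ?_ _ hA) ?_
      · rintro w hw rfl
        exact hF w (by simp) hw
      · have : {ω | ∀ z ∈ F, η z ω = f z} = ⋂ w ∈ F, η w ⁻¹' {f w} := by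
          ext; simp
        rw [this]
        refine MeasurableSet.biInter (Set.to_countable _) fun w hw => ?_
        refine measurableSet_envSigma_eq η ?_ _
        rintro rfl
        exact hz hw
    have hle := envSigma_le hm {w | w ≠ z}
    have hE : MeasurableSet (η z ⁻¹' {f z}) := hm z (measurableSet_singleton _)
    have h1 : ∫ ω in B, (μ⟦η z ⁻¹' {f z} | envSigma η {w | w ≠ z}⟧) ω ∂μ =
        μ.real (η z ⁻¹' {f z} ∩ B) := by
      rw [setIntegral_condExp hle ((integrable_const _).indicator hE) hBm,
        integral_indicator hE, Measure.restrict_restrict hE]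
      simp
    have h2 : c * μ.real B ≤ ∫ ω in B, (μ⟦η z ⁻¹' {f z} | envSigma η {w | w ≠ z}⟧) ω ∂μ := by
      have : ∫ _ in B, c ∂μ = c * μ.real B := by simp [mul_comm]
      rw [← this]
      refine integral_mono_ae (integrable_const _) integrable_condExp.integrableOn ?_
      filter_upwards [ae_restrict_of_ae (hU z (f z) (hf z (by simp)))] with ω hω using hω.le
    have h3 : A ∩ {ω | ∀ w ∈ insert z F, η w ω = f w} = η z ⁻¹' {f z} ∩ B := by
      ext ω
      simp only [hB, Finset.forall_mem_insert, Set.mem_inter_iff, Set.mem_ofPred_eq,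
        Set.mem_preimage, Set.mem_singleton_iff]
      tauto
    rw [h3, ← h1, Finset.card_insert_of_notMem hz, pow_succ']
    calc _ = c * (c ^ F.card * μ.real A) := by ring
      _ ≤ c * μ.real B := by gcongr
      _ ≤ _ := h2

end

/-! ### Extraction of a slab crossing and chaining of independent copies. -/

section

variable {d : ℕ} {Ω : Type*}

lemma exists_mem_crossing {l : EuclideanSpace ℝ (Fin d)} {e : (Fin d → ℤ) → (Fin d → ℤ)} {N : ℕ}
    {b : ℝ} (hb : b ≤ height l ((step e)^[N] 0)) :
    ∃ i T, i + T ≤ N ∧ b ≤ height l ((step e)^[i + T] 0 - (step e)^[i] 0) ∧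
      e ∈ crossing l T ((step e)^[i + T] 0 - (step e)^[i] 0) ((step e)^[i] 0) := by
  -- The crossing starts at a time `i` of minimal height and ends at the first later time `j` at or
  -- above the final height. The minimum is at most 0, so the piece climbs at least `b`.
  obtain ⟨i, hi, hmin⟩ := Finset.exists_min_image (Finset.range (N + 1))
    (fun t => height l ((step e)^[t] 0)) ⟨0, by simp⟩
  have hiN : i ≤ N := by simpa [Nat.lt_succ_iff] using hi
  have hex : ∃ j, i ≤ j ∧ height l ((step e)^[N] 0) ≤ height l ((step e)^[j] 0) :=
    ⟨N, hiN, le_rfl⟩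
  classical
  obtain ⟨hij, hj⟩ := Nat.find_spec hex
  have hjN : Nat.find hex ≤ N := Nat.find_min' hex ⟨hiN, le_rfl⟩
  have hlt : ∀ t, i ≤ t → t < Nat.find hex →
      height l ((step e)^[t] 0) < height l ((step e)^[N] 0) := fun t hit ht => by
    have := Nat.find_min hex ht
    push Not at this
    exact this hit
  generalize Nat.find hex = j at *
  obtain ⟨T, rfl⟩ := Nat.exists_eq_add_of_le hij
  have h0 : height l ((step e)^[i] 0) ≤ 0 := by simpa using hmin 0 (by simp)
  refine ⟨i, T, hjN, by rw [map_sub]; linarith, fun t ht => ?_, ?_⟩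
  · rw [add_sub_cancel, ← Function.iterate_add_apply, add_comm t]
    exact ⟨hmin _ (by simp; lia), (hlt _ (by lia) (by lia)).trans_le hj⟩
  · rw [add_sub_cancel, ← Function.iterate_add_apply, add_comm T]

lemma mem_box_of_norm_le {z : Fin d → ℤ} {K : ℕ} (h : ‖toVec z‖ ≤ K) :
    z ∈ Finset.Icc (fun _ : Fin d => -(K : ℤ)) (fun _ => (K : ℤ)) := by
  rw [Finset.mem_Icc]
  have h1 : ∀ i, |z i| ≤ (K : ℤ) := fun i => by
    have := (abs_le_norm_toVec z i).trans h
    exact_mod_cast this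
  exact ⟨fun i => (abs_le.1 (h1 i)).1, fun i => (abs_le.1 (h1 i)).2⟩

lemma card_box (K : ℕ) :
    (Finset.Icc (fun _ : Fin d => -(K : ℤ)) (fun _ => (K : ℤ))).card = (2 * K + 1) ^ d := by
  rw [Pi.card_Icc]
  simp only [Int.card_Icc, Finset.prod_const, Finset.card_univ, Fintype.card_fin]
  congr 1
  lia

lemma measurableSet_crossing_chain {η : (Fin d → ℤ) → Ω → (Fin d → ℤ)}
    (l : EuclideanSpace ℝ (Fin d)) (T : ℕ) (y w : Fin d → ℤ)
    (q : ℕ) :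
    MeasurableSet[envSigma η
      {z | ∃ j < q, height l (j • w) ≤ height l z ∧ height l z < height l (j • w + y)}]
      {ω | ∀ j < q, (fun z => η z ω) ∈ crossing l T y (j • w)} := by
  have : {ω | ∀ j < q, (fun z => η z ω) ∈ crossing l T y (j • w)} =
      ⋂ j ∈ Set.Iio q, {ω | (fun z => η z ω) ∈ crossing l T y (j • w)} := by
    ext; simp
  rw [this]
  refine MeasurableSet.biInter (Set.to_countable _) fun j hj => ?_
  refine envSigma_mono η ?_ _ (measurableSet_confined η _ T _ _)
  exact fun z hz => ⟨j, hj, hz⟩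

variable [MeasurableSpace Ω] {μ : Measure Ω} {η : (Fin d → ℤ) → Ω → (Fin d → ℤ)}

/-- Union bound over the duration, the starting point and the displacement, all confined to finite
boxes by the bounded jumps. Stationarity then moves the starting point to 0. -/
lemma exists_crossing_real_ge [IsProbabilityMeasure μ] (hη : IsEnvironment μ η) {L : ℕ}
    (hL : 1 ≤ L) (hbd : ∀ z, ∀ᵐ ω ∂μ, ‖toVec (η z ω)‖ ≤ L) {l : EuclideanSpace ℝ (Fin d)} {N : ℕ}
    (hN : 1 ≤ N) {b : ℝ} (hpos : 0 < μ.real {ω | b ≤ height l (walk η N ω)}) :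
    ∃ T ≤ N, ∃ y, b ≤ height l y ∧ μ.real {ω | b ≤ height l (walk η N ω)} ≤
      (5 * L * N : ℝ) ^ (2 * d + 1) *
        μ.real {ω | (fun z => η z ω) ∈ crossing l T y 0} := by
  classical
  by_contra! hcon
  set P := μ.real {ω | b ≤ height l (walk η N ω)} with hP
  set B := fun K : ℕ => Finset.Icc (fun _ : Fin d => -(K : ℤ)) (fun _ => (K : ℤ)) with hB
  set I := (Finset.range (N + 1) ×ˢ B (L * N)) ×ˢ ((B (2 * (L * N))).filter (b ≤ height l ·))
    with hI
  have hsub : ∀ᵐ ω ∂μ, ω ∈ {ω | b ≤ height l (walk η N ω)} →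
      ω ∈ ⋃ s ∈ I, {ω | (fun z => η z ω) ∈ crossing l s.1.1 s.2 s.1.2} := by
    filter_upwards [ae_all_iff.2 hbd] with ω hω hmem
    have hmem : b ≤ height l ((step fun z => η z ω)^[N] 0) := by
      rw [← walk_eq_iterate]; exact hmem
    obtain ⟨i, T, hiT, hby, hcr⟩ := exists_mem_crossing hmem
    have hnorm : ∀ t ≤ N, ‖toVec ((step fun z => η z ω)^[t] 0)‖ ≤ ((L * N : ℕ) : ℝ) :=
      fun t ht => (norm_step_iterate_le hω t).trans <| by
        push_cast
        rw [mul_comm]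
        gcongr
    refine Set.mem_biUnion (x := ((T, _), _)) ?_ hcr
    simp only [hI, Finset.mem_coe, Finset.mem_product, Finset.mem_filter, Finset.mem_range]
    refine ⟨⟨by lia, mem_box_of_norm_le (hnorm i (by lia))⟩, mem_box_of_norm_le ?_, hby⟩
    rw [toVec_sub]
    refine (norm_sub_le _ _).trans ?_
    have h1 := hnorm _ hiT
    have h2 := hnorm i (by lia)
    push_cast at h1 h2 ⊢
    linarith
  have hC : (0 : ℝ) < (5 * L * N : ℝ) ^ (2 * d + 1) := by positivity
  -- Each of `N + 1`, `2LN + 1` and `4LN + 1` is at most `5LN`, because `L, N ≥ 1`.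
  have hcard : (I.card : ℝ) ≤ (5 * L * N : ℝ) ^ (2 * d + 1) := by
    have h1 : I.card ≤ (N + 1) * (2 * (L * N) + 1) ^ d * (2 * (2 * (L * N)) + 1) ^ d := by
      rw [hI, Finset.card_product, Finset.card_product, Finset.card_range, ← card_box, ← card_box]
      gcongr
      exact Finset.filter_subset _ _
    have hLN : 1 ≤ L * N := Nat.mul_pos hL hN
    have hNLN : N ≤ L * N := Nat.le_mul_of_pos_left N hL
    have h2 : I.card ≤ (5 * L * N) ^ (2 * d + 1) := by
      refine h1.trans ?_
      rw [show (5 * L * N) ^ (2 * d + 1) =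
        (5 * (L * N)) * (5 * (L * N)) ^ d * (5 * (L * N)) ^ d by ring]
      gcongr <;> lia
    exact_mod_cast h2
  have hle : P ≤ ∑ s ∈ I, μ.real {ω | (fun z => η z ω) ∈ crossing l s.1.1 s.2 s.1.2} :=
    calc P ≤ μ.real (⋃ s ∈ I, {ω | (fun z => η z ω) ∈ crossing l s.1.1 s.2 s.1.2}) :=
          ENNReal.toReal_mono (measure_ne_top _ _) (measure_mono_ae hsub)
      _ ≤ _ := measureReal_biUnion_finset_le _ _
  have hIne : I.Nonempty := by
    by_contra h
    rw [Finset.not_nonempty_iff_eq_empty] at h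
    rw [h, Finset.sum_empty] at hle
    linarith
  have hlt : ∑ s ∈ I, μ.real {ω | (fun z => η z ω) ∈ crossing l s.1.1 s.2 s.1.2} <
      ∑ s ∈ I, P / (5 * L * N : ℝ) ^ (2 * d + 1) := by
    refine Finset.sum_lt_sum_of_nonempty hIne fun s hs => ?_
    simp only [hI, Finset.mem_product, Finset.mem_filter, Finset.mem_range] at hs
    rw [measureReal_def, measure_crossing_eq hη, ← measureReal_def, lt_div_iff₀' hC]
    exact hcon _ (by lia) _ hs.2.2
  rw [Finset.sum_const, nsmul_eq_mul, ← mul_div_assoc] at hlt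
  have : (I.card : ℝ) * P / (5 * L * N : ℝ) ^ (2 * d + 1) ≤ P := by
    rw [div_le_iff₀ hC, mul_comm]
    gcongr
  linarith

lemma real_crossing_chain_eq [IsProbabilityMeasure μ] (hη : IsEnvironment μ η) {M : ℝ}
    (hM : ∀ A B : Set (Fin d → ℤ), (∀ a ∈ A, ∀ b ∈ B, M < dist (toVec a) (toVec b)) →
      Indep (envSigma η A) (envSigma η B) μ)
    {l : EuclideanSpace ℝ (Fin d)} (hl : l ≠ 0) (T : ℕ) {y w : Fin d → ℤ}
    (hw : 0 ≤ height l w) (hyw : height l y + M * ‖l‖ ≤ height l w) (q : ℕ) :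
    μ.real {ω | ∀ j < q, (fun z => η z ω) ∈ crossing l T y (j • w)} =
      μ.real {ω | (fun z => η z ω) ∈ crossing l T y 0} ^ q := by
  induction q with
  | zero => simp
  | succ q ih =>
    have hind : Indep
        (envSigma η
          {z | ∃ j < q, height l (j • w) ≤ height l z ∧ height l z < height l (j • w + y)})
        (envSigma η {z | height l (q • w) ≤ height l z ∧ height l z < height l (q • w + y)}) μ := by
      refine hM _ _ ?_
      rintro a ⟨j, hj, -, ha⟩ b ⟨hb, -⟩
      have hjq : (j + 1 : ℝ) * height l w ≤ q * height l w := by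
        gcongr
        exact_mod_cast hj
      simp only [map_add, height_nsmul] at ha hb
      -- Strictness comes from the half-open slabs; by Cauchy–Schwarz the sites are then more than
      -- `M` apart.
      have h1 : M * ‖l‖ < height l (b - a) := by rw [map_sub]; linarith
      have h2 : height l (b - a) ≤ ‖l‖ * dist (toVec a) (toVec b) := by
        rw [height_apply, dist_comm, dist_eq_norm, ← toVec_sub]
        exact real_inner_le_norm _ _
      have h3 : 0 < ‖l‖ := norm_pos_iff.2 hl
      nlinarith
    have hset : {ω | ∀ j < q + 1, (fun z => η z ω) ∈ crossing l T y (j • w)} =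
        {ω | ∀ j < q, (fun z => η z ω) ∈ crossing l T y (j • w)} ∩
          {ω | (fun z => η z ω) ∈ crossing l T y (q • w)} := by
      ext ω
      simp only [Nat.forall_lt_succ_right, Set.mem_ofPred_eq, Set.mem_inter_iff]
    rw [hset, measureReal_def, (Indep_iff _ _ μ).1 hind _ {ω | _ ∈ crossing l T y (q • w)}
      (measurableSet_crossing_chain l T y w q) (measurableSet_confined η _ T (q • w) (q • w + y)), ENNReal.toReal_mul, ← measureReal_def, ih, pow_succ]
    congr 1
    exact congrArg ENNReal.toReal (measure_crossing_eq hη l T y (q • w))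

lemma step_iterate_of_forced {e : (Fin d → ℤ) → (Fin d → ℤ)} {x u : Fin d → ℤ} {m : ℕ}
    (h : ∀ i < m, e (x + i • u) = u) : ∀ i ≤ m, (step e)^[i] x = x + i • u := by
  intro i
  induction i with
  | zero => simp
  | succ i ih =>
    intro hi
    rw [Function.iterate_succ_apply', ih (by lia), step, h i (by lia), succ_nsmul]
    abel

/-- Each crossing is followed by `m` forced steps `u`, which lift the walk past the dependence
range; `r` further steps `u` adjust the total time. The forced sites avoid every slab, so their cost
multiplies that of the crossings. -/
lemma real_chain_ge [IsProbabilityMeasure μ] (hη : IsEnvironment μ η) {M : ℝ}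
    (hM : ∀ A B : Set (Fin d → ℤ), (∀ a ∈ A, ∀ b ∈ B, M < dist (toVec a) (toVec b)) →
      Indep (envSigma η A) (envSigma η B) μ)
    {U : Finset (Fin d → ℤ)} {c : ℝ} (hc : 0 < c) (hc1 : c ≤ 1)
    (hU : ∀ z, ∀ u ∈ U, ∀ᵐ ω ∂μ, c < (μ⟦η z ⁻¹' {u} | envSigma η {w | w ≠ z}⟧) ω)
    {l : EuclideanSpace ℝ (Fin d)} {u : Fin d → ℤ} (hu : u ∈ U) (hlu : 0 < height l u) {m : ℕ}
    (hm : M * ‖l‖ ≤ m * height l u) (T : ℕ) {y : Fin d → ℤ} (hy : 0 < height l y) (q r : ℕ) :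
    μ.real {ω | (fun z => η z ω) ∈ crossing l T y 0} ^ q * c ^ (q * m + r) ≤
      μ.real {ω | q * height l y ≤ height l (walk η (q * (T + m) + r) ω)} := by
  classical
  have hl : l ≠ 0 := by
    rintro rfl
    simp [height_apply] at hlu
  set w := y + m • u with hwdef
  have hhw : height l w = height l y + m * height l u := by rw [hwdef, map_add, height_nsmul]
  have hmu : 0 ≤ m * height l u := by positivity
  have hw : 0 ≤ height l w := by rw [hhw]; positivity
  rw [← real_crossing_chain_eq hη hM hl T hw (by linarith) q]
  set F : Finset (Fin d → ℤ) :=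
    (Finset.range q ×ˢ Finset.range m).image (fun s => s.1 • w + y + s.2 • u) ∪
      (Finset.range r).image (fun i => q • w + i • u) with hF
  have hFcard : F.card ≤ q * m + r := by
    refine (Finset.card_union_le _ _).trans ?_
    gcongr
    · exact Finset.card_image_le.trans (by simp)
    · exact Finset.card_image_le.trans (by simp)
  have key := measure_forced_ge (μ := μ) hη.measurable hc hU
    (measurableSet_crossing_chain (η := η) l T y w q) F ?_ (fun _ => u) (fun _ _ => hu)
  · rw [mul_comm]
    calc _ ≤ c ^ F.card * _ := by
          gcongr ?_ * _
          exact pow_le_pow_of_le_one hc.le hc1 hFcard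
      _ ≤ _ := key
      _ ≤ _ := measureReal_mono ?_
    rintro ω ⟨hcr, hfo⟩
    rw [Set.mem_ofPred_eq, walk_eq_iterate]
    have hbridge : ∀ j < q, ∀ i < m, η (j • w + y + i • u) ω = u := fun j hj i hi => by
      refine hfo _ ?_
      simp only [hF, Finset.mem_union, Finset.mem_image, Finset.mem_product, Finset.mem_range]
      exact Or.inl ⟨(j, i), ⟨hj, hi⟩, rfl⟩
    have hlast : ∀ i < r, η (q • w + i • u) ω = u := fun i hi => by
      refine hfo _ ?_
      simp only [hF, Finset.mem_union, Finset.mem_image, Finset.mem_product, Finset.mem_range]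
      exact Or.inr ⟨i, hi, rfl⟩
    have hblock : ∀ j ≤ q, (step fun z => η z ω)^[j * (T + m)] 0 = j • w := by
      intro j
      induction j with
      | zero => simp
      | succ j ih =>
        intro hj
        rw [show (j + 1) * (T + m) = m + (T + j * (T + m)) by ring, Function.iterate_add_apply,
          Function.iterate_add_apply, ih (by lia), (hcr j (by lia)).2,
          step_iterate_of_forced (hbridge j (by lia)) m le_rfl, succ_nsmul, hwdef, add_assoc]
    rw [add_comm, Function.iterate_add_apply, hblock q le_rfl,
      step_iterate_of_forced hlast r le_rfl]
    simp only [map_add, height_nsmul, hhw]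
    have : 0 ≤ q * (m * height l u) + r * height l u := by positivity
    linarith
  -- Bridge `a` lies at or above the top of slab `a` and strictly below the bottom of slab `a + 1`;
  -- the last `r` sites lie above all slabs.
  · rintro z hz ⟨j, hj, h1, h2⟩
    simp only [hF, Finset.mem_union, Finset.mem_image, Finset.mem_product, Finset.mem_range] at hz
    have mono : ∀ a b : ℕ, a < b → (a + 1 : ℝ) * height l w ≤ b * height l w := fun a b hab => by
      gcongr
      exact_mod_cast hab
    simp only [map_add, height_nsmul] at h1 h2
    rcases hz with ⟨⟨a, i⟩, ⟨ha, hi⟩, rfl⟩ | ⟨i, hi, rfl⟩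
    · simp only [map_add, height_nsmul] at h1 h2
      have hi1 : (i : ℝ) * height l u < m * height l u := by gcongr
      have hi0 : 0 ≤ (i : ℝ) * height l u := by positivity
      rcases lt_trichotomy a j with h | rfl | h
      · have := mono _ _ h
        linarith
      · linarith
      · have := mono _ _ h
        linarith
    · simp only [map_add, height_nsmul] at h1 h2
      have hi0 : 0 ≤ (i : ℝ) * height l u := by positivity
      have := mono _ _ hj
      linarith

end

/-! ### Trapping near the origin, and tail bounds from a repeated crossing. -/

section

variable {d : ℕ} {Ω : Type*}

/-- Compactness of the unit sphere makes niceness uniform. -/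
lemma Nice.exists_forall_le_inner {U : Finset (Fin d → ℤ)} (hU : Nice U) (hne : U.Nonempty) :
    ∃ δ > 0, ∀ l : EuclideanSpace ℝ (Fin d), ∃ u ∈ U, δ * ‖l‖ ≤ ⟪l, toVec u⟫ := by
  obtain ⟨δ, hδ, h⟩ := (isCompact_sphere (0 : EuclideanSpace ℝ (Fin d)) 1).exists_forall_le'
    (f := fun l => U.sup' hne fun u => ⟪l, toVec u⟫) (a := 0)
    (Continuous.finset_sup'_apply hne fun u _ => by fun_prop).continuousOn
    (fun l hl => by
      obtain ⟨u, hu, hlu⟩ := hU l (by rintro rfl; simp at hl)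
      exact hlu.trans_le (Finset.le_sup' (fun u => ⟪l, toVec u⟫) hu))
  refine ⟨δ, hδ, fun l => ?_⟩
  rcases eq_or_ne l 0 with rfl | hl
  · obtain ⟨u, hu⟩ := hne
    exact ⟨u, hu, by simp⟩
  · have hpos : 0 < ‖l‖ := norm_pos_iff.2 hl
    obtain ⟨u, hu, hlu⟩ := (Finset.le_sup'_iff hne).1
      (h (‖l‖⁻¹ • l) (by simp [norm_smul, hpos.ne']))
    refine ⟨u, hu, ?_⟩
    rw [real_inner_smul_left] at hlu
    calc δ * ‖l‖ ≤ ‖l‖⁻¹ * ⟪l, toVec u⟫ * ‖l‖ := by gcongr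
      _ = _ := by field_simp

lemma Nice.exists_invariant_ball {U : Finset (Fin d → ℤ)} (hU : Nice U) (hne : U.Nonempty) :
    ∃ R : ℝ, 0 ≤ R ∧ ∃ f : (Fin d → ℤ) → (Fin d → ℤ), (∀ z, f z ∈ U) ∧
      ∀ z, ‖toVec z‖ ≤ R → ‖toVec (z + f z)‖ ≤ R := by
  obtain ⟨δ, hδ, h⟩ := hU.exists_forall_le_inner hne
  choose f hfU hf using fun z : Fin d → ℤ => h (-toVec z)
  obtain ⟨K, hK⟩ : ∃ K : ℝ, ∀ u ∈ U, ‖toVec u‖ ≤ K := by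
    obtain ⟨K, hK⟩ := (U.image fun u => ‖toVec u‖).bddAbove
    exact ⟨K, fun u hu => hK (by simpa using ⟨u, hu, rfl⟩)⟩
  have hK0 : 0 ≤ K := (norm_nonneg _).trans (hK _ hne.choose_spec)
  -- The squared norm changes by at most `K ^ 2 - 2 * δ * ‖toVec z‖`, so it cannot grow beyond
  -- radius `K ^ 2 / (2 * δ)`; inside that radius one step adds at most `K`.
  refine ⟨K ^ 2 / (2 * δ) + K, by positivity, f, hfU, fun z hz => ?_⟩
  have hu := hK _ (hfU z)
  rw [toVec_add]
  rcases le_total ‖toVec z‖ (K ^ 2 / (2 * δ)) with h1 | h1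
  · exact (norm_add_le _ _).trans (add_le_add h1 hu)
  · refine le_trans (abs_le_of_sq_le_sq' ?_ (norm_nonneg _)).2 hz
    have h2 := hf z
    rw [norm_neg, inner_neg_left] at h2
    rw [div_le_iff₀ (by positivity)] at h1
    have h3 : ‖toVec (f z)‖ ^ 2 ≤ K ^ 2 := by gcongr
    rw [norm_add_sq_real]
    linarith

variable [MeasurableSpace Ω] {μ : Measure Ω} {η : (Fin d → ℤ) → Ω → (Fin d → ℤ)}

lemma exists_trap [IsProbabilityMeasure μ] (hη : IsEnvironment μ η) :
    ∃ R C : ℝ, 0 < C ∧ ∀ n, C ≤ μ.real {ω | ‖toVec (walk η n ω)‖ ≤ R} := by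
  obtain ⟨U, hnice, c, hc, hU⟩ := hη.elliptic
  rcases U.eq_empty_or_nonempty with rfl | hne
  -- The empty set is nice only when the space is trivial.
  · have h0 : ∀ l : EuclideanSpace ℝ (Fin d), l = 0 := fun l => by
      by_contra hl
      obtain ⟨u, hu, -⟩ := hnice l hl
      simp at hu
    refine ⟨0, 1, one_pos, fun n => ?_⟩
    simp [h0 (toVec _)]
  obtain ⟨R, hR, f, hfU, hf⟩ := hnice.exists_invariant_ball hne
  obtain ⟨K, hK⟩ := exists_nat_ge R
  classical
  set F := (Finset.Icc (fun _ : Fin d => -(K : ℤ)) (fun _ => (K : ℤ))).filter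
    (fun z => ‖toVec z‖ ≤ R) with hF
  refine ⟨R, c ^ F.card, by positivity, fun n => ?_⟩
  have key := measure_forced_ge (μ := μ) hη.measurable hc hU (S := ∅)
    (@MeasurableSet.univ Ω (envSigma η ∅)) F (by simp) f (fun z _ => hfU z)
  rw [probReal_univ, mul_one] at key
  refine key.trans (measureReal_mono ?_)
  rintro ω ⟨-, hω⟩
  rw [Set.mem_ofPred_eq, walk_eq_iterate]
  induction n with
  | zero => simpa [toVec_zero] using hR
  | succ n ih =>
    rw [Function.iterate_succ_apply', step, hω]
    · exact hf _ ih
    · rw [hF, Finset.mem_filter]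
      exact ⟨mem_box_of_norm_le (ih.trans hK), ih⟩

lemma coe_le_tailRate_iff [IsProbabilityMeasure μ] {k : ℝ} (hk : 0 < k)
    (l : EuclideanSpace ℝ (Fin d)) {n : ℕ} (hn : 0 < n) (s : ℝ) :
    (s : EReal) ≤ tailRate μ η (k⁻¹ • l) n ↔
      Real.exp (n * s) ≤ μ.real {ω | n * k ≤ height l (walk η n ω)} := by
  have hn' : (0 : ℝ) < n := by exact_mod_cast hn
  have hset : {ω | (n : ℝ) ≤ ⟪toVec (walk η n ω), k⁻¹ • l⟫} =
      {ω | n * k ≤ height l (walk η n ω)} := by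
    ext ω
    rw [Set.mem_ofPred_eq, Set.mem_ofPred_eq, real_inner_smul_right, real_inner_comm,
      ← height_apply, inv_mul_eq_div, le_div_iff₀ hk]
  rw [tailRate, hset]
  set S := {ω | n * k ≤ height l (walk η n ω)}
  rcases eq_or_ne (μ S) 0 with h | h
  · rw [h, ENNReal.log_zero, EReal.coe_mul_bot_of_pos (by positivity), measureReal_def, h]
    simp [Real.exp_pos]
  · have hpos : 0 < μ.real S := ENNReal.toReal_pos h (measure_ne_top _ _)
    rw [ENNReal.log_pos_real h (measure_ne_top _ _), ← measureReal_def, ← EReal.coe_mul,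
      EReal.coe_le_coe_iff, ← Real.le_log_iff_exp_le hpos, one_div, inv_mul_eq_div,
      le_div_iff₀' hn']

/-- Per unit time the chain climbs `β' = β / D` at exponential cost `σ = (log p + m log c) / D`. The
value `t < β' + σ` is reached at a speed slightly below `β'`. -/
lemma le_lowerPhi_of_chain [IsProbabilityMeasure μ] {l : EuclideanSpace ℝ (Fin d)} {p c β t : ℝ}
    {m D : ℕ} (hp : 0 < p) (hp1 : p ≤ 1) (hc : 0 < c) (hc1 : c ≤ 1) (hβ : 0 < β) (hD : 0 < D)
    (ht : 0 ≤ t) (hlt : t * D < β + Real.log p + m * Real.log c)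
    (h : ∀ q r : ℕ, p ^ q * c ^ (q * m + r) ≤
      μ.real {ω | q * β ≤ height l (walk η (q * D + r) ω)}) :
    ∃ k : ℝ, 0 < k ∧ ((t - k : ℝ) : EReal) ≤ lowerPhi μ η (k⁻¹ • l) := by
  have hD' : (0 : ℝ) < D := by exact_mod_cast hD
  have hlp : Real.log p ≤ 0 := Real.log_nonpos hp.le hp1
  have hlc : Real.log c ≤ 0 := Real.log_nonpos hc.le hc1
  have hmc : m * Real.log c ≤ 0 := mul_nonpos_of_nonneg_of_nonpos (by positivity) hlc
  obtain ⟨σ, hσ⟩ : ∃ σ, Real.log p + m * Real.log c = D * σ :=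
    ⟨(Real.log p + m * Real.log c) / D, by field_simp⟩
  obtain ⟨β', hβ'⟩ : ∃ β', β = D * β' := ⟨β / D, by field_simp⟩
  have hβ'0 : 0 < β' := by
    rw [hβ'] at hβ
    exact (pos_iff_pos_of_mul_pos hβ).1 hD'
  have hσ0 : σ ≤ 0 := by
    by_contra! hσ0
    have := mul_pos hD' hσ0
    linarith
  have hgap : t < β' + σ := by
    have : D * t < D * (β' + σ) := by linarith
    exact lt_of_mul_lt_mul_left this hD'.le
  -- With `k = β' - ε` one has `t - k = σ - ε`: a slack `ε` in speed and another in rate. They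
  -- absorb the height (at most `β`) and the cost (at most `-D log c`) of the incomplete last block.
  set ε := (β' + σ - t) / 2 with hε
  have hε0 : 0 < ε := by linarith
  have hk : 0 < β' - ε := by linarith
  refine ⟨β' - ε, hk, ?_⟩
  refine le_liminf_of_le (by isBoundedDefault) ?_
  obtain ⟨N, hN⟩ := exists_nat_ge ((β - D * Real.log c) / ε)
  rw [div_le_iff₀ hε0] at hN
  filter_upwards [eventually_ge_atTop N, eventually_gt_atTop 0] with n hn hn0
  rw [coe_le_tailRate_iff hk l hn0]
  have hnN : β - D * Real.log c ≤ n * ε := hN.trans (by gcongr)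
  have hDc : D * Real.log c ≤ 0 := mul_nonpos_of_nonneg_of_nonpos hD'.le hlc
  have hqr : ((n / D : ℕ) : ℝ) * D + ((n % D : ℕ) : ℝ) = n := by
    exact_mod_cast Nat.div_add_mod' n D
  have hr : ((n % D : ℕ) : ℝ) ≤ D := by exact_mod_cast (Nat.mod_lt n hD).le
  have key := h (n / D) (n % D)
  rw [Nat.div_add_mod'] at key
  generalize n / D = q at key hqr
  generalize n % D = r at key hqr hr
  have hr0 : (0 : ℝ) ≤ r := by positivity
  calc Real.exp (n * (t - (β' - ε)))
      ≤ Real.exp (q * Real.log p + (q * m + r) * Real.log c) := by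
        refine Real.exp_le_exp.2 ?_
        have e1 : q * Real.log p + (q * m + r) * Real.log c
            = (q * D) * σ + r * Real.log c := by
          linear_combination (q : ℝ) * hσ
        have e2 : (n : ℝ) * σ ≤ (q * D) * σ :=
          mul_le_mul_of_nonpos_right (by linarith) hσ0
        have e3 : D * Real.log c ≤ r * Real.log c := mul_le_mul_of_nonpos_right hr hlc
        have e4 : n * (t - (β' - ε)) = n * σ - n * ε := by rw [hε]; ring
        rw [e1, e4]
        linarith
    _ = p ^ q * c ^ (q * m + r) := by
        rw [Real.exp_add, ← Real.log_pow, Real.exp_log (by positivity)]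
        congr 1
        rw [← Real.exp_log (pow_pos hc (q * m + r)), Real.log_pow]
        push_cast
        rfl
    _ ≤ _ := key
    _ ≤ _ := by
        refine measureReal_mono ?_
        intro ω hω
        rw [Set.mem_ofPred_eq] at hω ⊢
        refine le_trans ?_ hω
        have : r * β' ≤ D * β' := by gcongr
        have e : (n : ℝ) * β' = q * β + r * β' := by rw [hβ', ← hqr]; ring
        linarith

/-- A single good time `N` of the limsup is bootstrapped to all large times. The condition `0 ≤ t`
gives `t * T ≤ t * N` for a crossing of duration `T ≤ N`. -/
lemma exists_le_add_lowerPhi [IsProbabilityMeasure μ] (hη : IsEnvironment μ η)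
    (l : EuclideanSpace ℝ (Fin d)) {k t : ℝ} (hk : 0 < k) (ht : 0 ≤ t)
    (hlt : (t : EReal) < k + upperPhi μ η (k⁻¹ • l)) :
    ∃ k' : ℝ, 0 < k' ∧ (t : EReal) ≤ k' + lowerPhi μ η (k'⁻¹ • l) := by
  obtain ⟨s, hts, hs⟩ : ∃ s : ℝ, t - k < s ∧ (s : EReal) < upperPhi μ η (k⁻¹ • l) := by
    have h : ((t - k : ℝ) : EReal) < upperPhi μ η (k⁻¹ • l) := by
      rw [EReal.coe_sub]
      exact EReal.sub_lt_of_lt_add' hlt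
    obtain ⟨s, h1, h2⟩ := EReal.lt_iff_exists_real_btwn.1 h
    exact ⟨s, by exact_mod_cast h1, h2⟩
  have hfreq : ∃ᶠ n in atTop, (s : EReal) < tailRate μ η (k⁻¹ • l) n :=
    frequently_lt_of_lt_limsup (by isBoundedDefault) hs
  have hl : l ≠ 0 := by
    rintro rfl
    obtain ⟨n, hn, hn0⟩ := (hfreq.and_eventually (eventually_gt_atTop 0)).exists
    rw [lt_iff_le_and_ne] at hn
    have h1 := (coe_le_tailRate_iff hk 0 hn0 s).1 hn.1
    have h2 : {ω | n * k ≤ height 0 (walk η n ω)} = ∅ := by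
      have : 0 < n * k := by positivity
      ext ω
      simpa [height_apply] using this
    rw [h2, measureReal_empty] at h1
    exact absurd h1 (not_le.2 (Real.exp_pos _))
  obtain ⟨U, hnice, c', hc', hU'⟩ := hη.elliptic
  obtain ⟨M, hM⟩ := hη.finiteRange
  obtain ⟨L', -, hL'⟩ := hη.bounded
  obtain ⟨u, hu, hlu⟩ := hnice l hl
  obtain ⟨L, hL⟩ := exists_nat_ge (max L' 1)
  have hL1 : 1 ≤ L := by exact_mod_cast (le_max_right _ _).trans hL
  have hbd : ∀ z, ∀ᵐ ω ∂μ, ‖toVec (η z ω)‖ ≤ L := fun z => by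
    filter_upwards [hL' z] with ω hω using hω.trans ((le_max_left _ _).trans hL)
  obtain ⟨c, hc, hc1, hU⟩ : ∃ c : ℝ, 0 < c ∧ c ≤ 1 ∧ ∀ z, ∀ u ∈ U,
      ∀ᵐ ω ∂μ, c < (μ⟦η z ⁻¹' {u} | envSigma η {w | w ≠ z}⟧) ω :=
    ⟨min c' 1, by positivity, min_le_right _ _, fun z u hu => by
      filter_upwards [hU' z u hu] with ω hω using (min_le_left _ _).trans_lt hω⟩
  obtain ⟨m, hm⟩ := exists_nat_ge (max (M * ‖l‖ / height l u) 1)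
  have hm1 : 1 ≤ m := by exact_mod_cast (le_max_right _ _).trans hm
  have hmM : M * ‖l‖ ≤ m * height l u :=
    (div_le_iff₀ hlu).1 ((le_max_left _ _).trans hm)
  have hLpos : (0 : ℝ) < L := by exact_mod_cast hL1
  -- The gap `k + s - t` is split in two: one half pays for the polynomial factor of the union
  -- bound, the other, through `N₀`, for the bridge.
  have hlog : ∀ᶠ N : ℕ in atTop, Real.log (5 * L * N) ≤
      (k + s - t) / (2 * (2 * d + 1) * (5 * L)) * (5 * L * N) := by
    have h1 : Tendsto (fun N : ℕ => 5 * L * (N : ℝ)) atTop atTop :=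
      tendsto_natCast_atTop_atTop.const_mul_atTop (by positivity)
    have h2 := (Real.isLittleO_log_id_atTop.comp_tendsto h1).def
      (c := (k + s - t) / (2 * (2 * d + 1) * (5 * L))) (by
        have : 0 < k + s - t := by linarith
        positivity)
    filter_upwards [h2] with N hN
    refine (le_abs_self _).trans (hN.trans_eq ?_)
    simp only [Function.comp, id, Real.norm_eq_abs]
    rw [abs_of_nonneg (by positivity)]
  obtain ⟨N₀, hN₀⟩ := exists_nat_gt ((t * m - m * Real.log c) / ((k + s - t) / 2))
  rw [div_lt_iff₀ (by linarith)] at hN₀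
  obtain ⟨N, hsN, hNlog, hN0, hNN₀⟩ := (hfreq.and_eventually
    (hlog.and ((eventually_gt_atTop 0).and (eventually_ge_atTop N₀)))).exists
  have hNpos : (0 : ℝ) < N := by exact_mod_cast hN0
  have hP := (coe_le_tailRate_iff hk l hN0 s).1 hsN.le
  obtain ⟨T, hT, y, hy, hPy⟩ := exists_crossing_real_ge hη hL1 hbd (l := l) hN0
    ((Real.exp_pos _).trans_le hP)
  set p := μ.real {ω | (fun z => η z ω) ∈ crossing l T y 0} with hpdef
  have hCpos : (0 : ℝ) < (5 * L * N : ℝ) ^ (2 * d + 1) := by positivity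
  have hexp := hP.trans hPy
  have hp : 0 < p := (pos_iff_pos_of_mul_pos ((Real.exp_pos _).trans_le hexp)).1 hCpos
  have hlogp : N * s ≤ (2 * d + 1) * Real.log (5 * L * N) + Real.log p := by
    rw [← Real.le_log_iff_exp_le (by positivity), Real.log_mul hCpos.ne' hp.ne',
      Real.log_pow] at hexp
    exact_mod_cast hexp
  have hβ : 0 < height l y := lt_of_lt_of_le (by positivity) hy
  have hlogd : (2 * d + 1) * Real.log (5 * L * N) ≤ N * ((k + s - t) / 2) := by
    calc (2 * d + 1) * Real.log (5 * L * N)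
        ≤ (2 * d + 1) * ((k + s - t) / (2 * (2 * d + 1) * (5 * L)) * (5 * L * N)) := by gcongr
      _ = _ := by field_simp
  have hgap : t * (T + m : ℕ) < height l y + Real.log p + m * Real.log c := by
    have h1 : (T : ℝ) ≤ N := by exact_mod_cast hT
    have h2 : t * T ≤ t * N := by gcongr
    have h3 : (N₀ : ℝ) * ((k + s - t) / 2) ≤ N * ((k + s - t) / 2) := by
      have : 0 < k + s - t := by linarith
      gcongr
    push_cast
    nlinarith
  obtain ⟨k', hk', hle⟩ := le_lowerPhi_of_chain (μ := μ) (η := η) (l := l) (t := t) hp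
    measureReal_le_one hc hc1 hβ (D := T + m) (m := m) (by lia) ht hgap
    (real_chain_ge hη hM hc hc1 hU hu hlu hmM T hβ)
  refine ⟨k', hk', ?_⟩
  calc (t : EReal) = k' + ((t - k' : ℝ) : EReal) := by
        rw [← EReal.coe_add, add_sub_cancel]
    _ ≤ _ := by gcongr

end

/-! ### Exponential moments: bounds, convexity and the limit. -/

section

variable {d : ℕ} {Ω : Type*} [MeasurableSpace Ω] {μ : Measure Ω}
  {η : (Fin d → ℤ) → Ω → (Fin d → ℤ)}

lemma exists_ae_height_walk_le [IsProbabilityMeasure μ] (hη : IsEnvironment μ η)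
    (l : EuclideanSpace ℝ (Fin d)) :
    ∃ B : ℝ, 0 ≤ B ∧ ∀ n : ℕ, ∀ᵐ ω ∂μ, height l (walk η n ω) ≤ n * B := by
  obtain ⟨L, hL, hbd⟩ := hη.bounded
  refine ⟨‖l‖ * L, by positivity, fun n => ?_⟩
  filter_upwards [ae_all_iff.2 hbd] with ω hω
  rw [walk_eq_iterate]
  calc _ ≤ ‖l‖ * ‖toVec ((step fun z => η z ω)^[n] 0)‖ := real_inner_le_norm _ _
    _ ≤ ‖l‖ * (n * L) := by
      gcongr
      exact norm_step_iterate_le hω n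
    _ = _ := by ring

lemma integrable_exp_height_walk [IsProbabilityMeasure μ] (hη : IsEnvironment μ η)
    (l : EuclideanSpace ℝ (Fin d)) (n : ℕ) :
    Integrable (fun ω => Real.exp (height l (walk η n ω))) μ := by
  obtain ⟨B, -, hB⟩ := exists_ae_height_walk_le hη l
  have hmeas : Measurable fun ω => Real.exp (height l (walk η n ω)) :=
    (measurable_of_countable fun z => Real.exp (height l z)).comp (measurable_walk hη.measurable n)
  refine Integrable.of_bound hmeas.aestronglyMeasurable (Real.exp (n * B)) ?_
  filter_upwards [hB n] with ω hω
  rw [Real.norm_eq_abs, Real.abs_exp]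
  exact Real.exp_le_exp.2 hω

/-- `(1/n) log E[exp (l · X_n)]`. -/
def logMgf (μ : Measure Ω) (η : (Fin d → ℤ) → Ω → (Fin d → ℤ)) (n : ℕ)
    (l : EuclideanSpace ℝ (Fin d)) : ℝ :=
  (1 / (n : ℝ)) * Real.log (∫ ω, Real.exp (height l (walk η n ω)) ∂μ)

lemma integral_exp_height_walk_pos [IsProbabilityMeasure μ] (hη : IsEnvironment μ η)
    (l : EuclideanSpace ℝ (Fin d)) (n : ℕ) :
    0 < ∫ ω, Real.exp (height l (walk η n ω)) ∂μ :=
  integral_exp_pos (integrable_exp_height_walk hη l n)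

lemma le_logMgf_iff [IsProbabilityMeasure μ] (hη : IsEnvironment μ η)
    (l : EuclideanSpace ℝ (Fin d)) {n : ℕ} (hn : 0 < n) (t : ℝ) :
    t ≤ logMgf μ η n l ↔ Real.exp (n * t) ≤ ∫ ω, Real.exp (height l (walk η n ω)) ∂μ := by
  rw [logMgf, ← Real.le_log_iff_exp_le (integral_exp_height_walk_pos hη l n), one_div,
    inv_mul_eq_div, le_div_iff₀' (by exact_mod_cast hn)]

lemma logMgf_le_iff [IsProbabilityMeasure μ] (hη : IsEnvironment μ η)
    (l : EuclideanSpace ℝ (Fin d)) {n : ℕ} (hn : 0 < n) (t : ℝ) :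
    logMgf μ η n l ≤ t ↔ ∫ ω, Real.exp (height l (walk η n ω)) ∂μ ≤ Real.exp (n * t) := by
  rw [logMgf, ← Real.log_le_iff_le_exp (integral_exp_height_walk_pos hη l n), one_div,
    inv_mul_eq_div, div_le_iff₀' (by exact_mod_cast hn)]

lemma exp_mul_real_le_integral [IsProbabilityMeasure μ] (hη : IsEnvironment μ η)
    (l : EuclideanSpace ℝ (Fin d)) (n : ℕ) (b : ℝ) :
    Real.exp b * μ.real {ω | b ≤ height l (walk η n ω)} ≤
      ∫ ω, Real.exp (height l (walk η n ω)) ∂μ := by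
  have h := mul_meas_ge_le_integral_of_nonneg
    (Eventually.of_forall fun ω => (Real.exp_pos (height l (walk η n ω))).le)
    (integrable_exp_height_walk hη l n) (Real.exp b)
  simpa only [Real.exp_le_exp] using h

lemma eventually_lt_logMgf_of_lt_add_lowerPhi [IsProbabilityMeasure μ] (hη : IsEnvironment μ η)
    (l : EuclideanSpace ℝ (Fin d)) {k t : ℝ} (hk : 0 < k)
    (hlt : (t : EReal) < k + lowerPhi μ η (k⁻¹ • l)) : ∀ᶠ n in atTop, t < logMgf μ η n l := by
  have h : ((t - k : ℝ) : EReal) < lowerPhi μ η (k⁻¹ • l) := by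
    rw [EReal.coe_sub]
    exact EReal.sub_lt_of_lt_add' hlt
  obtain ⟨s, hts, hs⟩ := EReal.lt_iff_exists_real_btwn.1 h
  have hts : t < k + s := by
    have : t - k < s := by exact_mod_cast hts
    linarith
  filter_upwards [eventually_lt_of_lt_liminf hs, eventually_gt_atTop 0] with n hn hn0
  refine hts.trans_le ((le_logMgf_iff hη l hn0 _).2 ?_)
  refine le_trans ?_ (exp_mul_real_le_integral hη l n (n * k))
  rw [mul_add, Real.exp_add]
  gcongr
  exact (coe_le_tailRate_iff hk l hn0 s).1 hn.le

/-- On the trapping event the exponential is bounded below independently of `n`, a contribution that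
vanishes after division by `n`. -/
lemma eventually_lt_logMgf_of_neg [IsProbabilityMeasure μ] (hη : IsEnvironment μ η)
    (l : EuclideanSpace ℝ (Fin d)) {t : ℝ} (ht : t < 0) :
    ∀ᶠ n in atTop, t < logMgf μ η n l := by
  obtain ⟨R, C, hC, h⟩ := exists_trap hη
  obtain ⟨N, hN⟩ := exists_nat_gt ((‖l‖ * R - Real.log C) / -t)
  rw [div_lt_iff₀ (by linarith)] at hN
  filter_upwards [eventually_ge_atTop N, eventually_gt_atTop 0] with n hn hn0
  have hn0' : (0 : ℝ) < n := by exact_mod_cast hn0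
  have hNn : (N : ℝ) * -t ≤ n * -t := by
    have : 0 < -t := by linarith
    gcongr
  have key : Real.exp (Real.log C - ‖l‖ * R) ≤ ∫ ω, Real.exp (height l (walk η n ω)) ∂μ := by
    refine le_trans ?_ (exp_mul_real_le_integral hη l n (-(‖l‖ * R)))
    rw [sub_eq_add_neg, Real.exp_add, Real.exp_log hC, mul_comm]
    gcongr
    refine (h n).trans (measureReal_mono fun ω hω => ?_)
    rw [Set.mem_ofPred_eq] at hω ⊢
    have h1 : -(‖l‖ * ‖toVec (walk η n ω)‖) ≤ height l (walk η n ω) :=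
      (abs_le.1 (abs_real_inner_le_norm _ _)).1
    have h2 : ‖l‖ * ‖toVec (walk η n ω)‖ ≤ ‖l‖ * R := by gcongr
    linarith
  have : (Real.log C - ‖l‖ * R) / n ≤ logMgf μ η n l := by
    rw [le_logMgf_iff hη l hn0, mul_div_cancel₀ _ hn0'.ne']
    exact key
  refine lt_of_lt_of_le ?_ this
  rw [lt_div_iff₀ hn0']
  linarith

lemma exp_le_sum_indicator {n : ℕ} {ε x : ℝ} {K : ℕ} (hn : 0 < n) (hε : 0 < ε)
    (hx : x ≤ n * (K * ε)) :
    Real.exp x ≤ Real.exp (n * ε) + ∑ j ∈ Finset.Icc 1 K,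
      Real.exp (n * ((j + 1) * ε)) * {y : ℝ | n * (j * ε) ≤ y}.indicator 1 x := by
  have hn' : (0 : ℝ) < n := by exact_mod_cast hn
  have hnn : ∀ j ∈ Finset.Icc 1 K, 0 ≤
      Real.exp (n * ((j + 1) * ε)) * {y : ℝ | n * (j * ε) ≤ y}.indicator 1 x := fun j _ =>
    mul_nonneg (Real.exp_pos _).le (Set.indicator_nonneg (fun _ _ => zero_le_one) _)
  rcases le_total x (n * ε) with h | h
  · have := Finset.sum_nonneg hnn
    have := Real.exp_le_exp.2 h
    linarith
  · set j := ⌊x / (n * ε)⌋₊ with hj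
    have hpos : 0 < n * ε := by positivity
    have h1 : (1 : ℝ) ≤ x / (n * ε) := by rwa [one_le_div hpos]
    have hj1 : 1 ≤ j := Nat.le_floor (by exact_mod_cast h1)
    have hjx : (j : ℝ) * (n * ε) ≤ x := (le_div_iff₀ hpos).1 (Nat.floor_le (by linarith))
    have hxj : x < (j + 1) * (n * ε) := (div_lt_iff₀ hpos).1 (Nat.lt_floor_add_one _)
    have hjK : j ≤ K := by
      have : (j : ℝ) ≤ K := by
        refine le_of_mul_le_mul_right ?_ hpos
        linarith
      exact_mod_cast this
    have h2 := Finset.single_le_sum hnn (Finset.mem_Icc.2 ⟨hj1, hjK⟩)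
    have hmem : x ∈ {y : ℝ | n * (j * ε) ≤ y} := by
      rw [Set.mem_ofPred_eq]
      linarith
    rw [Set.indicator_of_mem hmem, Pi.one_apply, mul_one] at h2
    have h3 : Real.exp x ≤ Real.exp (n * ((j + 1) * ε)) := Real.exp_le_exp.2 (by linarith)
    have := Real.exp_pos (n * ε)
    linarith

/-- Heights are cut at mesh `nε` with `ε = (t - a) / 2`. Level `j` contributes at most `e^{n(j+1)ε}
e^{n(a-jε)} = e^{n(a+ε)}`; heights below `nε` obey the same bound since `a ≥ 0`. The `K + 1` terms
cost a further `e^{nε}`. -/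
lemma eventually_logMgf_le_of_forall_upperPhi [IsProbabilityMeasure μ] (hη : IsEnvironment μ η)
    (l : EuclideanSpace ℝ (Fin d)) {a t : ℝ} (ha : 0 ≤ a) (hat : a < t)
    (h : ∀ k : ℝ, 0 < k → (k : EReal) + upperPhi μ η (k⁻¹ • l) < a) :
    ∀ᶠ n in atTop, logMgf μ η n l ≤ t := by
  obtain ⟨B, hB0, hB⟩ := exists_ae_height_walk_le hη l
  obtain ⟨ε, hε⟩ : ∃ ε, ε = (t - a) / 2 := ⟨_, rfl⟩
  have hε0 : 0 < ε := by linarith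
  obtain ⟨K, hK⟩ := exists_nat_ge (B / ε)
  rw [div_le_iff₀ hε0] at hK
  have htail : ∀ j ∈ Finset.Icc 1 K, ∀ᶠ n : ℕ in atTop,
      μ.real {ω | n * (j * ε) ≤ height l (walk η n ω)} ≤ Real.exp (n * (a - j * ε)) := by
    intro j hj
    have hj0 : (0 : ℝ) < j := by exact_mod_cast (Finset.mem_Icc.1 hj).1
    have hjε : 0 < j * ε := by positivity
    have hlt : upperPhi μ η ((j * ε)⁻¹ • l) < ((a - j * ε : ℝ) : EReal) := by
      by_contra! hcon
      refine absurd (h _ hjε) (not_lt.2 ?_)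
      calc (a : EReal) = (j * ε : ℝ) + ((a - j * ε : ℝ) : EReal) := by
            rw [← EReal.coe_add, add_sub_cancel]
        _ ≤ _ := by gcongr
    filter_upwards [eventually_lt_of_limsup_lt hlt, eventually_gt_atTop 0] with n hn hn0
    by_contra! hcon
    exact absurd ((coe_le_tailRate_iff hjε l hn0 _).2 hcon.le) (not_le.2 hn)
  obtain ⟨N, hN⟩ := exists_nat_ge (Real.log (K + 1) / ε)
  rw [div_le_iff₀ hε0] at hN
  filter_upwards [(Finset.eventually_all _).2 htail, eventually_ge_atTop N,
    eventually_gt_atTop 0] with n hn hnN hn0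
  rw [logMgf_le_iff hη l hn0]
  set X := fun ω => height l (walk η n ω) with hX
  have hXm : Measurable X :=
    (measurable_of_countable (height l)).comp (measurable_walk hη.measurable n)
  have hS : ∀ j : ℕ, MeasurableSet {y : ℝ | n * (j * ε) ≤ y} := fun j => measurableSet_Ici
  have hint : ∀ j : ℕ, Integrable (fun ω => Real.exp (n * ((j + 1) * ε)) *
      {y : ℝ | n * (j * ε) ≤ y}.indicator 1 (X ω)) μ := fun j =>
    ((integrable_const (1 : ℝ)).indicator (hXm (hS j))).const_mul _
  calc ∫ ω, Real.exp (X ω) ∂μ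
      ≤ ∫ ω, (Real.exp (n * ε) + ∑ j ∈ Finset.Icc 1 K, Real.exp (n * ((j + 1) * ε)) *
          {y : ℝ | n * (j * ε) ≤ y}.indicator 1 (X ω)) ∂μ := by
        refine integral_mono_ae (integrable_exp_height_walk hη l n)
          ((integrable_const _).add (integrable_finsetSum _ fun j _ => hint j)) ?_
        filter_upwards [hB n] with ω hω
        exact exp_le_sum_indicator hn0 hε0 (hω.trans (by gcongr))
    _ = Real.exp (n * ε) + ∑ j ∈ Finset.Icc 1 K, Real.exp (n * ((j + 1) * ε)) *
          μ.real {ω | n * (j * ε) ≤ X ω} := by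
        rw [integral_add (integrable_const _) (integrable_finsetSum _ fun j _ => hint j),
          integral_finsetSum _ fun j _ => hint j]
        congr 1
        · simp
        · refine Finset.sum_congr rfl fun j _ => ?_
          rw [integral_const_mul]
          congr 1
          exact integral_indicator_one (hXm (hS j))
    _ ≤ Real.exp (n * (a + ε)) + ∑ j ∈ Finset.Icc 1 K, Real.exp (n * (a + ε)) := by
        gcongr with j hj
        · linarith
        · calc _ ≤ Real.exp (n * ((j + 1) * ε)) * Real.exp (n * (a - j * ε)) := by
                gcongr
                exact hn j hj
            _ = _ := by
                rw [← Real.exp_add]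
                congr 1
                ring
    _ = Real.exp (n * (a + ε)) * (K + 1) := by
        rw [Finset.sum_const, Nat.card_Icc, nsmul_eq_mul]
        push_cast [Nat.add_sub_cancel]
        ring
    _ ≤ Real.exp (n * (a + ε)) * Real.exp (n * ε) := by
        gcongr
        rw [← Real.log_le_iff_le_exp (by positivity)]
        refine hN.trans ?_
        gcongr
    _ = Real.exp (n * t) := by
        rw [← Real.exp_add]
        congr 1
        rw [hε]
        ring

/-- Hölder's inequality in disguise: both exponentials are normalized to mean 1, then convexity of
`exp` is applied pointwise and integrated. -/
lemma convexOn_logMgf [IsProbabilityMeasure μ] (hη : IsEnvironment μ η) (n : ℕ) :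
    ConvexOn ℝ Set.univ (logMgf μ η n) := by
  refine ⟨convex_univ, fun x _ y _ a b ha hb hab => ?_⟩
  have hx := integral_exp_height_walk_pos hη x n
  have hy := integral_exp_height_walk_pos hη y n
  have hix := integrable_exp_height_walk hη x n
  have hiy := integrable_exp_height_walk hη y n
  obtain ⟨A, hA⟩ : ∃ A, A = Real.log (∫ ω, Real.exp (height x (walk η n ω)) ∂μ) := ⟨_, rfl⟩
  obtain ⟨B, hB⟩ : ∃ B, B = Real.log (∫ ω, Real.exp (height y (walk η n ω)) ∂μ) := ⟨_, rfl⟩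
  have key : ∫ ω, Real.exp (height (a • x + b • y) (walk η n ω)) ∂μ ≤ Real.exp (a * A + b * B) := by
    calc _ ≤ ∫ ω, Real.exp (a * A + b * B) * (a * (Real.exp (height x (walk η n ω)) / Real.exp A) +
            b * (Real.exp (height y (walk η n ω)) / Real.exp B)) ∂μ := by
          refine integral_mono (integrable_exp_height_walk hη _ n)
            ((((hix.div_const _).const_mul _).add ((hiy.div_const _).const_mul _)).const_mul _)
            fun ω => ?_
          have h := convexOn_exp.2 (Set.mem_univ (height x (walk η n ω) - A))
            (Set.mem_univ (height y (walk η n ω) - B)) ha hb hab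
          simp only [smul_eq_mul, Real.exp_sub] at h
          have h2 : height (a • x + b • y) (walk η n ω) = (a * A + b * B) +
              (a * (height x (walk η n ω) - A) + b * (height y (walk η n ω) - B)) := by
            simp only [height_apply, inner_add_left, real_inner_smul_left]
            ring
          simp only
          rw [h2, Real.exp_add]
          gcongr
      _ = Real.exp (a * A + b * B) := by
          rw [integral_const_mul, integral_add ((hix.div_const _).const_mul _)
            ((hiy.div_const _).const_mul _), integral_const_mul, integral_const_mul,
            integral_div, integral_div, hA, hB, Real.exp_log hx, Real.exp_log hy,
            div_self hx.ne', div_self hy.ne', mul_one, mul_one, hab, mul_one]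
  have hlog := (Real.log_le_iff_le_exp (integral_exp_height_walk_pos hη _ n)).2 key
  simp only [logMgf, smul_eq_mul, ← hA, ← hB]
  calc _ ≤ (1 / (n : ℝ)) * (a * A + b * B) := by gcongr
    _ = _ := by ring

lemma iSup_upperPhi_le [IsProbabilityMeasure μ] (hη : IsEnvironment μ η)
    (l : EuclideanSpace ℝ (Fin d)) :
    max 0 (⨆ (k : ℝ) (_ : 0 < k), (k : EReal) + upperPhi μ η (k⁻¹ • l)) ≤
      max 0 (⨆ (k : ℝ) (_ : 0 < k), (k : EReal) + lowerPhi μ η (k⁻¹ • l)) := by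
  refine max_le (le_max_left _ _) (iSup₂_le fun k hk => ?_)
  refine le_of_forall_lt fun s hs => ?_
  obtain ⟨t, hst, ht⟩ := EReal.lt_iff_exists_real_btwn.1 hs
  refine hst.trans_le ?_
  rcases lt_or_ge t 0 with h0 | h0
  · exact le_max_of_le_left (by exact_mod_cast h0.le)
  · obtain ⟨k', hk', hle⟩ := exists_le_add_lowerPhi hη l hk h0 ht
    exact le_max_of_le_right
      (hle.trans (le_iSup₂ (f := fun (k : ℝ) (_ : 0 < k) =>
        (k : EReal) + lowerPhi μ η (k⁻¹ • l)) k' hk'))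

lemma iSup_lowerPhi_le (l : EuclideanSpace ℝ (Fin d)) :
    max 0 (⨆ (k : ℝ) (_ : 0 < k), (k : EReal) + lowerPhi μ η (k⁻¹ • l)) ≤
      max 0 (⨆ (k : ℝ) (_ : 0 < k), (k : EReal) + upperPhi μ η (k⁻¹ • l)) := by
  gcongr
  exact liminf_le_limsup

lemma exists_tendsto_logMgf [IsProbabilityMeasure μ] (hη : IsEnvironment μ η)
    (l : EuclideanSpace ℝ (Fin d)) :
    ∃ a : ℝ, Tendsto (fun n => logMgf μ η n l) atTop (𝓝 a) ∧
      (a : EReal) = max 0 (⨆ (k : ℝ) (_ : 0 < k), (k : EReal) + lowerPhi μ η (k⁻¹ • l)) ∧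
      (a : EReal) = max 0 (⨆ (k : ℝ) (_ : 0 < k), (k : EReal) + upperPhi μ η (k⁻¹ • l)) := by
  have heq := (iSup_lowerPhi_le (μ := μ) (η := η) l).antisymm (iSup_upperPhi_le hη l)
  rw [← heq]
  set G := max 0 (⨆ (k : ℝ) (_ : 0 < k), (k : EReal) + lowerPhi μ η (k⁻¹ • l)) with hG
  have hlower : ∀ t : ℝ, (t : EReal) < G → ∀ᶠ n in atTop, t < logMgf μ η n l := by
    intro t ht
    rcases lt_max_iff.1 ht with h | h
    · exact eventually_lt_logMgf_of_neg hη l (by exact_mod_cast h)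
    · obtain ⟨k, hk⟩ := lt_iSup_iff.1 h
      obtain ⟨hk0, hk⟩ := lt_iSup_iff.1 hk
      exact eventually_lt_logMgf_of_lt_add_lowerPhi hη l hk0 hk
  have hG0 : 0 ≤ G := le_max_left _ _
  -- An infinite value would push `logMgf` above the deterministic bound `B` on the height per step.
  have hGtop : G ≠ ⊤ := by
    intro htop
    obtain ⟨B, -, hB⟩ := exists_ae_height_walk_le hη l
    obtain ⟨n, hn, hn0⟩ := ((hlower B (htop ▸ EReal.coe_lt_top B)).and
      (eventually_gt_atTop 0)).exists
    refine absurd hn (not_lt.2 ((logMgf_le_iff hη l hn0 B).2 ?_))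
    calc _ ≤ ∫ _, Real.exp (n * B) ∂μ := by
          refine integral_mono_ae (integrable_exp_height_walk hη l n) (integrable_const _) ?_
          filter_upwards [hB n] with ω hω using Real.exp_le_exp.2 hω
      _ = _ := by simp
  lift G to ℝ using ⟨hGtop, (EReal.bot_lt_zero.trans_le hG0).ne'⟩ with g
  have hg0 : 0 ≤ g := by exact_mod_cast hG0
  refine ⟨g, tendsto_order.2 ⟨fun t ht => hlower t (by exact_mod_cast ht), fun t ht => ?_⟩,
    rfl, rfl⟩
  obtain ⟨t', h1, h2⟩ := exists_between ht
  obtain ⟨a, h3, h4⟩ := exists_between h1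
  have hup : ∀ k : ℝ, 0 < k → (k : EReal) + upperPhi μ η (k⁻¹ • l) < a := fun k hk => by
    refine lt_of_le_of_lt ?_ (EReal.coe_lt_coe_iff.2 h3)
    rw [heq]
    exact le_max_of_le_right (le_iSup₂ (f := fun (k : ℝ) (_ : 0 < k) =>
      (k : EReal) + upperPhi μ η (k⁻¹ • l)) k hk)
  filter_upwards [eventually_logMgf_le_of_forall_upperPhi hη l (hg0.trans h3.le) h4 hup] with n hn
    using hn.trans_lt h2

end

end DetWalk

end

theorem theorem5p2 {d : ℕ} {Ω : Type*} [MeasurableSpace Ω] (μ : Measure Ω)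
    [IsProbabilityMeasure μ] (η : (Fin d → ℤ) → Ω → (Fin d → ℤ))
    (hη : DetWalk.IsEnvironment μ η) :
    ∃ Λ : EuclideanSpace ℝ (Fin d) → ℝ,
      (∀ v, (∀ n, Integrable (fun ω => Real.exp ⟪v, DetWalk.toVec (DetWalk.walk η n ω)⟫) μ) ∧
        Tendsto (fun n : ℕ => (1 / (n : ℝ)) *
          Real.log (∫ ω, Real.exp ⟪v, DetWalk.toVec (DetWalk.walk η n ω)⟫ ∂μ))
          atTop (𝓝 (Λ v))) ∧
      ConvexOn ℝ Set.univ Λ ∧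
      (∀ v, (Λ v : EReal) =
        max 0 (⨆ (k : ℝ) (_ : 0 < k), (k : EReal) + DetWalk.lowerPhi μ η (k⁻¹ • v))) ∧
      (∀ v, (Λ v : EReal) =
        max 0 (⨆ (k : ℝ) (_ : 0 < k), (k : EReal) + DetWalk.upperPhi μ η (k⁻¹ • v))) ∧
      (0 : EuclideanSpace ℝ (Fin d)) ∈ interior {v | (Λ v : EReal) < ⊤} := by
  choose Λ hΛ hlow hup using fun l => DetWalk.exists_tendsto_logMgf hη l
  refine ⟨Λ, fun v => ⟨DetWalk.integrable_exp_height_walk hη v, hΛ v⟩, ?_, hlow, hup, ?_⟩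
  · refine ⟨convex_univ, fun x hx y hy a b ha hb hab => ?_⟩
    exact le_of_tendsto_of_tendsto' (hΛ _) (((hΛ x).const_smul a).add ((hΛ y).const_smul b))
      fun n => (DetWalk.convexOn_logMgf hη n).2 hx hy ha hb hab
  · simp [EReal.coe_lt_top]
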